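/- Let $n\ge 2$, let $\mathbf{B}^n=\{x\in\mathbf{R}^n:|x|<1\}$ be the open unit ball and $\partial\mathbf{B}^n$ the unit sphere, with normalized area measure $\sigma$ (so $\sigma(\partial\mathbf{B}^n)=1$). For $x\in\mathbf{B}^n$ and a unit vector $\ell\in\partial\mathbf{B}^n$, let $\mathcal{C}(x;\ell)$ be the smallest number such that $$|\langle\nabla U(x),\ell\rangle|\le \mathcal{C}(x;\ell)\,\sup_{y\in\mathbf{B}^n}|U(y)|$$ for every bounded real-valued harmonic function $U$ in $\mathbf{B}^n$. Then, for every $x\in\mathbf{B}^n$ and every $\ell\in\partial\mathbf{B}^n$, this smallest number exists and $$\mathcal{C}(x;\ell)=(1-|x|)^{-1}\,C(x;\ell),$$ where $$C(x;\ell)=\frac{n}{1+|x|}\int_{\partial\mathbf{B}^n}\left|\left\langle\eta-\frac{n-2}{n}x,\ \ell\right\rangle\right|\,|\eta-x|^{2-n}\,d\sigma(\eta).$$ -/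

import Mathlib

noncomputable section

/-- The normalized surface measure `σ` on the unit sphere of `ℝⁿ` (total mass one when `n ≥ 1`). -/
def sphereMeasure (n : ℕ) :
    MeasureTheory.Measure (Metric.sphere (0 : EuclideanSpace ℝ (Fin n)) 1) :=
  ((MeasureTheory.volume : MeasureTheory.Measure (EuclideanSpace ℝ (Fin n))).toSphere Set.univ)⁻¹ •
    (MeasureTheory.volume : MeasureTheory.Measure (EuclideanSpace ℝ (Fin n))).toSphere

/-- `U` is a bounded harmonic function in the open unit ball of `ℝⁿ`. Values of `U` outside the
ball are irrelevant. -/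
def IsBoundedHarmonic {n : ℕ} (U : EuclideanSpace ℝ (Fin n) → ℝ) : Prop :=
  InnerProductSpace.HarmonicOnNhd U (Metric.ball 0 1) ∧
    BddAbove ((fun y => |U y|) '' Metric.ball 0 1)

/-- The numbers `c` such that `|⟨∇U(x), ℓ⟩| ≤ c · sup_{|y| < 1} |U(y)|` for every bounded harmonic
function `U` in the unit ball. -/
def admissibleConstants {n : ℕ} (x ℓ : EuclideanSpace ℝ (Fin n)) : Set ℝ :=
  {c | ∀ U : EuclideanSpace ℝ (Fin n) → ℝ, IsBoundedHarmonic U →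
    |inner ℝ (gradient U x) ℓ| ≤
      c * ⨆ y : Metric.ball (0 : EuclideanSpace ℝ (Fin n)) 1, |U y|}

/-- The optimal constant `𝒞(x; ℓ)` in the gradient estimate at `x` in the direction `ℓ`. -/
def optimalConstant {n : ℕ} (x ℓ : EuclideanSpace ℝ (Fin n)) : ℝ :=
  sInf (admissibleConstants x ℓ)

/-- `C(x; ℓ) = n / (1 + |x|) · ∫ |⟨η - ((n - 2) / n) x, ℓ⟩| |η - x|^(2 - n) dσ(η)`. -/
def sphereFactor {n : ℕ} (x ℓ : EuclideanSpace ℝ (Fin n)) : ℝ :=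
  (n : ℝ) / (1 + ‖x‖) *
    ∫ η : Metric.sphere (0 : EuclideanSpace ℝ (Fin n)) 1,
      |inner ℝ ((η : EuclideanSpace ℝ (Fin n)) - (((n : ℝ) - 2) / (n : ℝ)) • x) ℓ| *
        ‖(η : EuclideanSpace ℝ (Fin n)) - x‖ ^ ((2 : ℤ) - (n : ℤ)) ∂(sphereMeasure n)

end

/-!
The proof writes the optimal constant as an `L¹` norm of the differentiated Poisson kernel and then
moves this integral along the chords of the sphere through `x`.

Let `P(x, η) = (1 - |x|²) |x - η|⁻ⁿ`. For `U` harmonic near the closed ball the Poisson formula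
(`poissonIntegral_eq_of_harmonicOnNhd`) gives `⟨∇U(x), ℓ⟩ = ∫ U(η) ⟨∇ₓP(x, η), ℓ⟩ dσ(η)`, hence
`|⟨∇U(x), ℓ⟩| ≤ I · sup |U|` with `I = ∫ |⟨∇ₓP(x, η), ℓ⟩| dσ(η)`. A general bounded harmonic `U`
is reached through the dilates `U(r ·)`, `r → 1`. The Poisson integral of the sign of
`⟨∇ₓP(x, ·), ℓ⟩` is harmonic, bounded by one, and attains equality, so `I` is the least admissible
constant (`isLeast_admissibleConstants`).

The Poisson formula rests on the maximum principle alone: rotation invariance of `σ` makes `∫ P dσ`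
constant on spheres about the origin, hence constant and equal to one, and then the Poisson integral
of a continuous function has the right boundary values, uniformly.

The closed form of `I` comes from the map `T` sending `η` to the other endpoint of the chord
through `η` and `x`. It has spherical Jacobian `((1 - |x|²) / |η - x|²)ⁿ⁻¹`
(`integral_sphereMeasure_chordMap`), and
`⟨∇ₓP(x, Tη), ℓ⟩ = -n ⟨η - ((n - 2) / n) x, ℓ⟩ |η - x|ⁿ (1 - |x|²)⁻ⁿ`
(`ballPoissonKernelDeriv_chordMap`), so that a single power `|η - x|²⁻ⁿ` is left.
-/

section

open MeasureTheory Metric Set Filter Topology InnerProductSpace Laplacian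
open scoped ContDiff

local notation "𝔼" n => EuclideanSpace ℝ (Fin n)

/-! ### Integration over the unit sphere -/

/-- Integration in polar coordinates of a function of the direction alone: the normalized surface
integral is the mean over the unit ball of the degree-zero homogeneous extension. -/
theorem integral_sphereMeasure_eq_integral_ball {n : ℕ} (hn : 0 < n) (F : (𝔼 n) → ℝ) :
    ∫ η : sphere (0 : 𝔼 n) 1, F η ∂(sphereMeasure n) =
      (volume.real (ball (0 : 𝔼 n) 1))⁻¹ * ∫ y in ball (0 : 𝔼 n) 1 \ {0}, F (‖y‖⁻¹ • y) := by
  have : NeZero n := ⟨hn.ne'⟩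
  set μ : Measure (𝔼 n) := volume
  -- The cutoff to radii below one makes the radial integral finite; it equals `1 / n`.
  let G : sphere (0 : 𝔼 n) 1 × Ioi (0 : ℝ) → ℝ := fun p =>
    F p.1 * (Iio (⟨1, mem_Ioi.2 one_pos⟩ : Ioi (0 : ℝ))).indicator 1 p.2
  have h1 := μ.measurePreserving_homeomorphUnitSphereProd.integral_comp
    (Homeomorph.measurableEmbedding _) G
  have h2 : ∫ p, G p ∂(μ.toSphere.prod (Measure.volumeIoiPow (Module.finrank ℝ (𝔼 n) - 1))) =
      (∫ η, F η ∂μ.toSphere) * (n : ℝ)⁻¹ := by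
    rw [integral_prod_mul (fun η : sphere (0 : 𝔼 n) 1 => F η)
      ((Iio (⟨1, mem_Ioi.2 one_pos⟩ : Ioi (0 : ℝ))).indicator 1)]
    rw [integral_indicator_one measurableSet_Iio, measureReal_def,
      Measure.volumeIoiPow_apply_Iio]
    simp only [finrank_euclideanSpace, Fintype.card_fin]
    rw [ENNReal.toReal_ofReal (by positivity), Nat.cast_sub hn]
    simp
  have h3 : ∫ y : ({0}ᶜ : Set (𝔼 n)), G (homeomorphUnitSphereProd (𝔼 n) y) ∂(μ.comap (↑)) =
      ∫ y in ball (0 : 𝔼 n) 1 \ {0}, F (‖y‖⁻¹ • y) ∂μ := by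
    have : ∀ y : ({0}ᶜ : Set (𝔼 n)), G (homeomorphUnitSphereProd (𝔼 n) y) =
        (ball (0 : 𝔼 n) 1).indicator (fun y => F (‖y‖⁻¹ • y)) y := by
      intro y
      simp only [G, indicator, mem_Iio, mem_ball_zero_iff, Pi.one_apply, ← Subtype.coe_lt_coe,
        homeomorphUnitSphereProd_apply_fst_coe, homeomorphUnitSphereProd_apply_snd_coe]
      split_ifs <;> simp
    simp_rw [this]
    rw [integral_subtype_comap (measurableSet_singleton _).compl
      ((ball (0 : 𝔼 n) 1).indicator (fun y => F (‖y‖⁻¹ • y))),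
      setIntegral_indicator measurableSet_ball]
    congr 2
    ext y; simp [and_comm]
  rw [h2, h3] at h1
  have hn' : (n : ℝ) ≠ 0 := by positivity
  rw [h1, sphereMeasure, integral_smul_measure, μ.toSphere_apply_univ]
  simp only [finrank_euclideanSpace, Fintype.card_fin, ENNReal.toReal_inv, ENNReal.toReal_mul,
    ENNReal.toReal_natCast, smul_eq_mul, measureReal_def, mul_inv]
  ring

theorem isProbabilityMeasure_sphereMeasure {n : ℕ} (hn : 0 < n) :
    IsProbabilityMeasure (sphereMeasure n) := by
  have : NeZero n := ⟨hn.ne'⟩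
  constructor
  rw [sphereMeasure, Measure.smul_apply, smul_eq_mul]
  refine ENNReal.inv_mul_cancel ?_ (measure_ne_top _ _)
  simp [hn.ne', IsOpen.measure_ne_zero]

theorem integral_sphereMeasure_comp_isometry {n : ℕ} (hn : 0 < n) (g : (𝔼 n) ≃ₗᵢ[ℝ] (𝔼 n))
    (F : (𝔼 n) → ℝ) :
    ∫ η : sphere (0 : 𝔼 n) 1, F (g η) ∂(sphereMeasure n) =
      ∫ η : sphere (0 : 𝔼 n) 1, F η ∂(sphereMeasure n) := by
  rw [integral_sphereMeasure_eq_integral_ball hn (fun η => F (g η)),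
    integral_sphereMeasure_eq_integral_ball hn F]
  congr 1
  have h := g.measurePreserving.setIntegral_preimage_emb
    g.toHomeomorph.measurableEmbedding (fun y => F (‖y‖⁻¹ • y)) (ball (0 : 𝔼 n) 1 \ {0})
  rw [← h]
  have hs : g ⁻¹' (ball (0 : 𝔼 n) 1 \ {0}) = ball (0 : 𝔼 n) 1 \ {0} := by
    ext y; simp
  rw [hs]
  simp

/-- The second endpoint of the chord of the unit sphere which starts at `η` and passes through the
interior point `x`. -/
noncomputable def chordMap {n : ℕ} (x η : 𝔼 n) : 𝔼 n :=
  x - ((1 - ‖x‖ ^ 2) / ‖η - x‖ ^ 2) • (η - x)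

section chord

variable {n : ℕ} {x η : 𝔼 n}

theorem sub_ne_zero_of_norm_lt (hx : ‖x‖ < 1) (hη : ‖η‖ = 1) : η - x ≠ 0 := by
  rw [sub_ne_zero]; rintro rfl; linarith

theorem one_sub_norm_sq_pos (hx : ‖x‖ < 1) : 0 < 1 - ‖x‖ ^ 2 := by
  nlinarith [norm_nonneg x]

theorem chordMap_sub (x η : 𝔼 n) :
    chordMap x η - x = -((1 - ‖x‖ ^ 2) / ‖η - x‖ ^ 2) • (η - x) := by
  rw [chordMap]; module

theorem norm_chordMap_sub (hx : ‖x‖ < 1) (hη : ‖η‖ = 1) :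
    ‖chordMap x η - x‖ = (1 - ‖x‖ ^ 2) / ‖η - x‖ := by
  have h1 := norm_pos_iff.2 (sub_ne_zero_of_norm_lt hx hη)
  have h2 := one_sub_norm_sq_pos hx
  rw [chordMap_sub, norm_smul, norm_neg, Real.norm_of_nonneg (by positivity)]
  field_simp

theorem norm_chordMap (hx : ‖x‖ < 1) (hη : ‖η‖ = 1) : ‖chordMap x η‖ = 1 := by
  have h1 := norm_pos_iff.2 (sub_ne_zero_of_norm_lt hx hη)
  have h2 := one_sub_norm_sq_pos hx
  have h3 : ‖η‖ ^ 2 = ‖x‖ ^ 2 + 2 * inner ℝ x (η - x) + ‖η - x‖ ^ 2 := by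
    rw [← norm_add_sq_real]; simp
  have h4 : ‖chordMap x η‖ ^ 2 = 1 := by
    rw [chordMap, norm_sub_sq_real, norm_smul, inner_smul_right,
      Real.norm_of_nonneg (by positivity)]
    rw [hη] at h3
    have : inner ℝ x (η - x) = (1 - ‖x‖ ^ 2 - ‖η - x‖ ^ 2) / 2 := by linarith
    rw [this]
    field_simp
    ring
  exact (pow_eq_one_iff_of_nonneg (norm_nonneg _) two_ne_zero).1 h4

theorem chordMap_chordMap (hx : ‖x‖ < 1) (hη : ‖η‖ = 1) : chordMap x (chordMap x η) = η := by
  have h1 := norm_pos_iff.2 (sub_ne_zero_of_norm_lt hx hη)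
  have h2 := one_sub_norm_sq_pos hx
  rw [chordMap, norm_chordMap_sub hx hη, chordMap_sub, smul_smul]
  have : (1 - ‖x‖ ^ 2) / ((1 - ‖x‖ ^ 2) / ‖η - x‖) ^ 2 * -((1 - ‖x‖ ^ 2) / ‖η - x‖ ^ 2) = -1 := by
    field_simp
  rw [this]
  module

/-- The chord map acts on `η` itself as the reflection in the hyperplane orthogonal to the chord. -/
theorem reflection_eq_chordMap (hx : ‖x‖ < 1) (hη : ‖η‖ = 1) :
    (ℝ ∙ (η - x))ᗮ.reflection η = chordMap x η := by
  have h1 := sub_ne_zero_of_norm_lt hx hη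
  have h := Submodule.reflection_sub (v := η) (w := chordMap x η)
    (by rw [hη, norm_chordMap hx hη])
  have h1' := norm_pos_iff.2 h1
  have h2 := one_sub_norm_sq_pos hx
  have h3 : η - chordMap x η = (1 + (1 - ‖x‖ ^ 2) / ‖η - x‖ ^ 2) • (η - x) := by
    rw [chordMap]; module
  have hs : (ℝ ∙ (η - chordMap x η)) = ℝ ∙ (η - x) := by
    rw [h3]
    exact Submodule.span_singleton_smul_eq (IsUnit.mk0 _ (by positivity)) _
  simp only [hs] at h
  exact h

theorem hasFDerivAt_chordMap (hx : ‖x‖ < 1) (hη : ‖η‖ = 1) :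
    HasFDerivAt (chordMap x) (-((1 - ‖x‖ ^ 2) / ‖η - x‖ ^ 2) •
      ((ℝ ∙ (η - x))ᗮ.reflection : (𝔼 n) →L[ℝ] (𝔼 n))) η := by
  have h2 := one_sub_norm_sq_pos hx
  -- `chordMap x` is the inversion in the sphere of radius `√(1 - |x|²)` about `x`, followed by the
  -- point reflection in `x`.
  have h := (EuclideanGeometry.hasFDerivAt_inversion (c := x) (x := η)
    (R := √(1 - ‖x‖ ^ 2)) (by rintro rfl; linarith)).const_sub ((2 : ℝ) • x)
  rw [dist_eq_norm, div_pow, Real.sq_sqrt h2.le] at h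
  rw [neg_smul]
  refine h.congr_of_eventuallyEq (Eventually.of_forall fun y => ?_)
  simp only [EuclideanGeometry.inversion, chordMap, dist_eq_norm, div_pow, Real.sq_sqrt h2.le,
    vsub_eq_sub, vadd_eq_add]
  module

/-- The extension of the chord map to `ℝⁿ` which is homogeneous of degree one. -/
noncomputable def coneChordMap (x y : 𝔼 n) : 𝔼 n := ‖y‖ • chordMap x (‖y‖⁻¹ • y)

theorem norm_inv_norm_smul {y : 𝔼 n} (hy : y ≠ 0) : ‖‖y‖⁻¹ • y‖ = 1 := by
  have := norm_pos_iff.2 hy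
  rw [norm_smul, norm_inv, norm_norm]
  field_simp

theorem norm_coneChordMap (hx : ‖x‖ < 1) {y : 𝔼 n} (hy : y ≠ 0) : ‖coneChordMap x y‖ = ‖y‖ := by
  rw [coneChordMap, norm_smul, norm_chordMap hx (norm_inv_norm_smul hy), norm_norm, mul_one]

theorem inv_norm_smul_coneChordMap (hx : ‖x‖ < 1) {y : 𝔼 n} (hy : y ≠ 0) :
    ‖coneChordMap x y‖⁻¹ • coneChordMap x y = chordMap x (‖y‖⁻¹ • y) := by
  have := norm_pos_iff.2 hy
  rw [norm_coneChordMap hx hy, coneChordMap, smul_smul, inv_mul_cancel₀ this.ne', one_smul]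

theorem coneChordMap_coneChordMap (hx : ‖x‖ < 1) {y : 𝔼 n} (hy : y ≠ 0) :
    coneChordMap x (coneChordMap x y) = y := by
  have := norm_pos_iff.2 hy
  rw [coneChordMap, inv_norm_smul_coneChordMap hx hy, chordMap_chordMap hx (norm_inv_norm_smul hy),
    norm_coneChordMap hx hy, smul_smul, mul_inv_cancel₀ this.ne', one_smul]

/-- The derivative of the cone extension: a reflection after a map which fixes the radial direction
and scales the tangential ones. -/
theorem hasFDerivAt_coneChordMap (hx : ‖x‖ < 1) {y : 𝔼 n} (hy : y ≠ 0) :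
    HasFDerivAt (coneChordMap x)
      (((ℝ ∙ (‖y‖⁻¹ • y - x))ᗮ.reflection : (𝔼 n) →L[ℝ] (𝔼 n)) ∘L
        (-((1 - ‖x‖ ^ 2) / ‖‖y‖⁻¹ • y - x‖ ^ 2) • ContinuousLinearMap.id ℝ (𝔼 n) +
          (1 + (1 - ‖x‖ ^ 2) / ‖‖y‖⁻¹ • y - x‖ ^ 2) •
            (innerSL ℝ (‖y‖⁻¹ • y)).smulRight (‖y‖⁻¹ • y))) y := by
  have hy' := norm_pos_iff.2 hy
  have hη := norm_inv_norm_smul hy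
  have hnorm : HasFDerivAt (fun z : 𝔼 n => ‖z‖) (‖y‖⁻¹ • innerSL ℝ y) y := by
    have h := ((hasStrictFDerivAt_norm_sq y).hasFDerivAt).sqrt (by positivity)
    simp only [Real.sqrt_sq (norm_nonneg _)] at h
    refine h.congr_fderiv ?_
    ext1 v
    simp
    field_simp
  have hinv : HasFDerivAt (fun z : 𝔼 n => ‖z‖⁻¹) (-(‖y‖ ^ 2)⁻¹ • ‖y‖⁻¹ • innerSL ℝ y) y :=
    (hasDerivAt_inv hy'.ne').comp_hasFDerivAt y hnorm
  have hdir := hinv.smul (hasFDerivAt_id y)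
  have hcomp := HasFDerivAt.comp (f := fun z : 𝔼 n => ‖z‖⁻¹ • z) y
    (hasFDerivAt_chordMap hx hη) hdir
  have h := hnorm.smul hcomp
  refine h.congr_fderiv ?_
  ext1 v
  have e1 : chordMap x (‖y‖⁻¹ • y) = (ℝ ∙ (‖y‖⁻¹ • y - x))ᗮ.reflection (‖y‖⁻¹ • y) :=
    (reflection_eq_chordMap hx hη).symm
  simp only [Function.comp, id, add_apply, smul_apply, ContinuousLinearMap.smulRight_apply,
    ContinuousLinearMap.comp_apply, innerSL_apply_apply,
    ContinuousLinearMap.id_apply, e1, ContinuousLinearEquiv.coe_coe,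
    LinearIsometryEquiv.coe_toContinuousLinearEquiv, map_add, map_smul]
  generalize (ℝ ∙ (‖y‖⁻¹ • y - x))ᗮ.reflection y = a
  generalize (ℝ ∙ (‖y‖⁻¹ • y - x))ᗮ.reflection v = b
  generalize (1 - ‖x‖ ^ 2) / ‖‖y‖⁻¹ • y - x‖ ^ 2 = t
  simp only [smul_eq_mul]
  match_scalars <;> field_simp
  ring

theorem abs_det_reflection (v : 𝔼 n) :
    |LinearMap.det ((ℝ ∙ v)ᗮ.reflection).toLinearMap| = 1 := by
  rw [Submodule.det_reflection, abs_pow, abs_neg, abs_one, one_pow]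

/-- An isometry composed with the map `-t • id + (1 + t) ⟨η, ·⟩ η`, which fixes the unit vector `η`
and is `-t` on its orthogonal complement, scales volume by `tⁿ⁻¹`. -/
theorem abs_det_isometry_comp_radial_scaling (hn : 0 < n) (R : (𝔼 n) ≃ₗᵢ[ℝ] (𝔼 n))
    (hR : |LinearMap.det R.toLinearMap| = 1) {t : ℝ} (ht : 0 < t) (hη : ‖η‖ = 1) :
    |((R : (𝔼 n) →L[ℝ] (𝔼 n)) ∘L (-t • ContinuousLinearMap.id ℝ (𝔼 n) +
          (1 + t) • (innerSL ℝ η).smulRight η)).det| = t ^ (n - 1) := by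
  have h1 : ((-t • ContinuousLinearMap.id ℝ (𝔼 n) +
      (1 + t) • (innerSL ℝ η).smulRight η : (𝔼 n) →L[ℝ] (𝔼 n)) : (𝔼 n) →ₗ[ℝ] (𝔼 n)) =
      (-t) • LinearMap.transvection (((-t)⁻¹ * (1 + t)) • (innerₛₗ ℝ η)) η := by
    ext1 v
    simp only [ContinuousLinearMap.coe_coe, add_apply, smul_apply, ContinuousLinearMap.id_apply,
      ContinuousLinearMap.smulRight_apply, innerSL_apply_apply, LinearMap.smul_apply,
      LinearMap.transvection.apply, innerₛₗ_apply_apply, smul_eq_mul]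
    match_scalars <;> field_simp
  rw [ContinuousLinearMap.det, ContinuousLinearMap.toLinearMap_comp, LinearMap.det_comp, h1,
    LinearMap.det_smul, LinearMap.transvection.det]
  have h2 : LinearMap.det ((R : (𝔼 n) →L[ℝ] (𝔼 n)) : (𝔼 n) →ₗ[ℝ] (𝔼 n)) =
    LinearMap.det R.toLinearMap := rfl
  rw [h2, abs_mul, hR, one_mul]
  simp only [finrank_euclideanSpace, Fintype.card_fin, LinearMap.smul_apply, innerₛₗ_apply_apply,
    real_inner_self_eq_norm_sq, hη, smul_eq_mul]
  obtain ⟨m, rfl⟩ : ∃ m, n = m + 1 := ⟨n - 1, by omega⟩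
  have h3 : 1 + (-t)⁻¹ * (1 + t) * 1 ^ 2 = -t⁻¹ := by field_simp; ring
  rw [h3, abs_mul, abs_pow, abs_neg, abs_neg, abs_inv, abs_of_pos ht, Nat.add_sub_cancel, pow_succ]
  field_simp

/-- Change of variables on the sphere along the chords through `x`. It is proved by applying the
Euclidean change of variables formula to the cone extension of the chord map. -/
theorem integral_sphereMeasure_chordMap (hn : 0 < n) (hx : ‖x‖ < 1) (F : (𝔼 n) → ℝ) :
    ∫ η : sphere (0 : 𝔼 n) 1, F η ∂(sphereMeasure n) =
      ∫ η : sphere (0 : 𝔼 n) 1, ((1 - ‖x‖ ^ 2) / ‖(η : 𝔼 n) - x‖ ^ 2) ^ (n - 1) *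
        F (chordMap x η) ∂(sphereMeasure n) := by
  rw [integral_sphereMeasure_eq_integral_ball hn F, integral_sphereMeasure_eq_integral_ball hn
    (fun η => ((1 - ‖x‖ ^ 2) / ‖η - x‖ ^ 2) ^ (n - 1) * F (chordMap x η))]
  congr 1
  set s : Set (𝔼 n) := ball 0 1 \ {0} with hs
  have hs0 : ∀ y ∈ s, y ≠ 0 := fun y hy => hy.2
  have hmem : ∀ y ∈ s, coneChordMap x y ∈ s := by
    intro y hy
    have := norm_coneChordMap hx (hs0 y hy)
    refine ⟨?_, ?_⟩
    · rw [mem_ball_zero_iff, this]; exact mem_ball_zero_iff.1 hy.1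
    · rw [mem_singleton_iff, ← norm_eq_zero, this, norm_eq_zero]; exact hs0 y hy
  have himage : coneChordMap x '' s = s := by
    refine Subset.antisymm (image_subset_iff.2 hmem) fun y hy => ?_
    exact ⟨_, hmem y hy, coneChordMap_coneChordMap hx (hs0 y hy)⟩
  have hinj : InjOn (coneChordMap x) s := by
    intro y hy z hz h
    rw [← coneChordMap_coneChordMap hx (hs0 y hy), h, coneChordMap_coneChordMap hx (hs0 z hz)]
  have h := integral_image_eq_integral_abs_det_fderiv_smul volume
    (measurableSet_ball.diff (measurableSet_singleton 0))
    (fun y hy => (hasFDerivAt_coneChordMap hx (hs0 y hy)).hasFDerivWithinAt) hinj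
    (fun y => F (‖y‖⁻¹ • y))
  rw [← hs, himage] at h
  rw [h]
  refine setIntegral_congr_fun (measurableSet_ball.diff (measurableSet_singleton 0)) fun y hy => ?_
  have hη := norm_inv_norm_smul (hs0 y hy)
  have h1 := norm_pos_iff.2 (sub_ne_zero_of_norm_lt hx hη)
  have h2 := one_sub_norm_sq_pos hx
  simp only
  rw [inv_norm_smul_coneChordMap hx (hs0 y hy), abs_det_isometry_comp_radial_scaling hn _
    (abs_det_reflection _) (by positivity) hη, smul_eq_mul]

end chord

/-! ### The maximum principle -/

/-- Second order necessary condition: at a local maximum of a `C²` function the second directional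
derivatives are nonpositive. -/
theorem IsLocalMax.fderiv_fderiv_nonpos {E : Type*} [NormedAddCommGroup E] [NormedSpace ℝ E]
    {f : E → ℝ} {a : E} (hmax : IsLocalMax f a) (hf : ContDiffAt ℝ 2 f a) (e : E) :
    fderiv ℝ (fderiv ℝ f) a e e ≤ 0 := by
  by_contra! hpos
  have hline : ∀ t : ℝ, HasDerivAt (fun t : ℝ => a + t • e) e t := fun t => by
    simpa using ((hasDerivAt_id t).smul_const e).const_add a
  have hcont : Tendsto (fun t : ℝ => a + t • e) (𝓝 0) (𝓝 a) := by
    simpa using (hline 0).continuousAt.tendsto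
  have hd1 : deriv (fun t : ℝ => f (a + t • e)) =ᶠ[𝓝 0] fun t => fderiv ℝ f (a + t • e) e := by
    have : ∀ᶠ y in 𝓝 a, ContDiffAt ℝ 2 f y := hf.eventually (by simp)
    filter_upwards [hcont.eventually this] with t ht
    exact ((ht.differentiableAt (by simp)).hasFDerivAt.comp_hasDerivAt t (hline t)).deriv
  have hd2 : deriv (deriv fun t : ℝ => f (a + t • e)) 0 = fderiv ℝ (fderiv ℝ f) a e e := by
    rw [hd1.deriv_eq]
    have h1 : DifferentiableAt ℝ (fderiv ℝ f) a :=
      (hf.fderiv_right (m := 1) (by norm_num)).differentiableAt (by norm_num)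
    have h2 : HasFDerivAt (fun y => fderiv ℝ f y e) ((fderiv ℝ (fderiv ℝ f) a).flip e) a := by
      refine (h1.hasFDerivAt.clm_apply (hasFDerivAt_const e a)).congr_fderiv ?_
      ext1 v
      simp
    have h3 : HasFDerivAt (fun y => fderiv ℝ f y e) ((fderiv ℝ (fderiv ℝ f) a).flip e)
        (a + (0 : ℝ) • e) := by
      rw [zero_smul, add_zero]
      exact h2
    exact (h3.comp_hasDerivAt (0 : ℝ) (hline 0)).deriv
  have hmax' : IsLocalMax (fun t : ℝ => f (a + t • e)) 0 := by
    have := hcont.eventually hmax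
    filter_upwards [this] with t ht
    simpa using ht
  -- A positive second derivative makes the point a local minimum as well, so `f` would be constant
  -- along the line near `a`, with vanishing second derivative.
  have hmin' : IsLocalMin (fun t : ℝ => f (a + t • e)) 0 := by
    refine isLocalMin_of_deriv_deriv_pos (by rw [hd2]; exact hpos) hmax'.deriv_eq_zero ?_
    have h1 : ContinuousAt f (a + (0 : ℝ) • e) := by simpa using hf.continuousAt
    exact ContinuousAt.comp (g := f) (f := fun t : ℝ => a + t • e) h1 (hline 0).continuousAt
  have hconst : (fun t : ℝ => f (a + t • e)) =ᶠ[𝓝 0] fun _ => f (a + (0 : ℝ) • e) := by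
    filter_upwards [hmax', hmin'] with t h1 h2
    exact le_antisymm h1 h2
  have : deriv (deriv fun t : ℝ => f (a + t • e)) 0 = 0 := by
    rw [hconst.deriv.deriv_eq]
    simp
  rw [hd2] at this
  exact hpos.ne' this

theorem laplacian_eq_sum_fderiv_fderiv {n : ℕ} (f : (𝔼 n) → ℝ) (x : 𝔼 n) :
    Δ f x = ∑ i, fderiv ℝ (fderiv ℝ f) x (EuclideanSpace.basisFun (Fin n) ℝ i)
      (EuclideanSpace.basisFun (Fin n) ℝ i) := by
  rw [laplacian_eq_iteratedFDeriv_orthonormalBasis f (EuclideanSpace.basisFun (Fin n) ℝ)]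
  simp [iteratedFDeriv_two_apply]

theorem laplacian_const_mul_norm_sq {n : ℕ} (ε : ℝ) (x : 𝔼 n) :
    Δ (fun y : 𝔼 n => ε * ‖y‖ ^ 2) x = 2 * n * ε := by
  rw [laplacian_eq_sum_fderiv_fderiv]
  have h1 : fderiv ℝ (fun y : 𝔼 n => ε * ‖y‖ ^ 2) =
      fun y => (ε • 2 • innerSL ℝ : (𝔼 n) →L[ℝ] (𝔼 n) →L[ℝ] ℝ) y := by
    ext1 y
    rw [fderiv_const_mul ((contDiff_norm_sq ℝ (n := 1)).differentiable (by simp) y)]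
    rw [fderiv_norm_sq_apply]
    rfl
  rw [h1]
  simp only [ContinuousLinearMap.fderiv]
  have : ∀ i, (ε • 2 • innerSL ℝ : (𝔼 n) →L[ℝ] (𝔼 n) →L[ℝ] ℝ)
      (EuclideanSpace.basisFun (Fin n) ℝ i)
      (EuclideanSpace.basisFun (Fin n) ℝ i) = ε * 2 := by
    intro i
    have h2 : ‖EuclideanSpace.basisFun (Fin n) ℝ i‖ = 1 := OrthonormalBasis.norm_eq_one _ i
    calc _ = ε * (2 • inner ℝ (EuclideanSpace.basisFun (Fin n) ℝ i)
          (EuclideanSpace.basisFun (Fin n) ℝ i)) := rfl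
      _ = _ := by rw [real_inner_self_eq_norm_sq, h2]; norm_num
  simp only [this]
  simp
  ring

/-- The maximum principle for harmonic functions on a closed ball. -/
theorem le_of_harmonicOnNhd_of_le_on_sphere {n : ℕ} (hn : 0 < n) {w : (𝔼 n) → ℝ} {ρ c : ℝ}
    (hw : HarmonicOnNhd w (closedBall 0 ρ)) (hc : ∀ z, ‖z‖ = ρ → w z ≤ c) {y : 𝔼 n}
    (hy : ‖y‖ ≤ ρ) : w y ≤ c := by
  have hρ : 0 ≤ ρ := (norm_nonneg y).trans hy
  -- Adding `ε |y|²` makes the Laplacian positive, which excludes interior maxima.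
  have key : ∀ ε > 0, w y ≤ c + ε * ρ ^ 2 := by
    intro ε hε
    set u : (𝔼 n) → ℝ := w + fun y => ε * ‖y‖ ^ 2 with hu
    have hsq : ContDiff ℝ 2 (fun y : 𝔼 n => ε * ‖y‖ ^ 2) := contDiff_const.mul (contDiff_norm_sq ℝ)
    have hcont : ContinuousOn u (closedBall 0 ρ) := hw.continuousOn.add hsq.continuous.continuousOn
    obtain ⟨z, hz, hzmax⟩ := (isCompact_closedBall (0 : 𝔼 n) ρ).exists_isMaxOn
      ⟨y, by simpa using hy⟩ hcont
    have hz' : ‖z‖ = ρ := by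
      by_contra hne
      have hlt : ‖z‖ < ρ := lt_of_le_of_ne (by simpa using hz) hne
      have hloc : IsLocalMax u z :=
        hzmax.isLocalMax (closedBall_mem_nhds_of_mem (by simpa using hlt))
      have hC : ContDiffAt ℝ 2 u z := (hw z hz).1.add hsq.contDiffAt
      have h1 : Δ u z = 2 * n * ε := by
        rw [hu, (hw z hz).1.laplacian_add hsq.contDiffAt, laplacian_const_mul_norm_sq,
          (hw z hz).2.eq_of_nhds]
        simp
      have h2 : Δ u z ≤ 0 := by
        rw [laplacian_eq_sum_fderiv_fderiv]
        exact Finset.sum_nonpos fun i _ => hloc.fderiv_fderiv_nonpos hC _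
      have : 0 < 2 * (n : ℝ) * ε := by positivity
      linarith
    have h1 : u y ≤ u z := hzmax (by simpa using hy)
    have h2 : u z ≤ c + ε * ρ ^ 2 := by
      simp only [hu, Pi.add_apply, hz']
      linarith [hc z hz']
    have h3 : w y ≤ u y := by simp only [hu, Pi.add_apply]; nlinarith [sq_nonneg ‖y‖]
    linarith
  refine le_of_forall_pos_le_add fun δ hδ => ?_
  refine (key (δ / (ρ ^ 2 + 1)) (by positivity)).trans ?_
  gcongr
  rw [div_mul_eq_mul_div, div_le_iff₀ (by positivity)]
  nlinarith

/-! ### The Poisson kernel of the ball -/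

/-- The Poisson kernel `(1 - |x|²) / |x - η|ⁿ` of the unit ball, written with a real power of
`|x - η|²`, which is smooth away from `x = η` for every parity of `n`. -/
noncomputable def ballPoissonKernel {n : ℕ} (x η : 𝔼 n) : ℝ :=
  (1 - ‖x‖ ^ 2) * (‖x - η‖ ^ 2) ^ (-(n : ℝ) / 2)

/-- The differential of `ballPoissonKernel` in its first variable. -/
noncomputable def ballPoissonKernelDeriv {n : ℕ} (x η : 𝔼 n) : (𝔼 n) →L[ℝ] ℝ :=
  (-2 * (‖x - η‖ ^ 2) ^ (-(n : ℝ) / 2)) • innerSL ℝ x -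
    (n * (1 - ‖x‖ ^ 2) * (‖x - η‖ ^ 2) ^ (-(n : ℝ) / 2 - 1)) • innerSL ℝ (x - η)

section

variable {n : ℕ} {x η : 𝔼 n}

theorem hasFDerivAt_norm_sub_sq_rpow (h : x ≠ η) (p : ℝ) :
    HasFDerivAt (fun y : 𝔼 n => (‖y - η‖ ^ 2) ^ p)
      ((2 * p * (‖x - η‖ ^ 2) ^ (p - 1)) • innerSL ℝ (x - η)) x := by
  have h0 : 0 < ‖x - η‖ := norm_pos_iff.2 (sub_ne_zero.2 h)
  have h1 := (((hasFDerivAt_id x).sub_const η).norm_sq).rpow_const (p := p) (Or.inl (by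
    simp only [id]; positivity))
  refine h1.congr_fderiv ?_
  ext1 v
  simp
  ring

theorem hasFDerivAt_one_sub_norm_sq (x : 𝔼 n) :
    HasFDerivAt (fun y : 𝔼 n => 1 - ‖y‖ ^ 2) ((-2 : ℝ) • innerSL ℝ x) x := by
  refine ((hasStrictFDerivAt_norm_sq x).hasFDerivAt.const_sub 1).congr_fderiv ?_
  ext1 v
  simp

theorem hasFDerivAt_ballPoissonKernel (h : x ≠ η) :
    HasFDerivAt (fun y => ballPoissonKernel y η) (ballPoissonKernelDeriv x η) x := by
  refine ((hasFDerivAt_one_sub_norm_sq x).mul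
    (hasFDerivAt_norm_sub_sq_rpow h (-(n : ℝ) / 2))).congr_fderiv ?_
  ext1 v
  simp [ballPoissonKernelDeriv]
  ring

theorem contDiffAt_ballPoissonKernel (h : x ≠ η) {m : WithTop ℕ∞} :
    ContDiffAt ℝ m (Function.uncurry (ballPoissonKernel (n := n))) (x, η) := by
  have h0 : 0 < ‖x - η‖ := norm_pos_iff.2 (sub_ne_zero.2 h)
  refine ContDiffAt.mul ?_ ?_
  · exact contDiffAt_const.sub (contDiffAt_fst.norm_sq ℝ)
  · exact ((contDiffAt_fst.sub contDiffAt_snd).norm_sq ℝ).rpow_const_of_ne (by simp; positivity)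

theorem laplacian_ballPoissonKernel (h : x ≠ η) (hη : ‖η‖ = 1) :
    Δ (fun y => ballPoissonKernel y η) x = 0 := by
  have h0 : 0 < ‖x - η‖ := norm_pos_iff.2 (sub_ne_zero.2 h)
  have hev : fderiv ℝ (fun y => ballPoissonKernel y η) =ᶠ[𝓝 x]
      fun y => ballPoissonKernelDeriv y η := by
    filter_upwards [isOpen_ne.mem_nhds h] with y hy
    exact (hasFDerivAt_ballPoissonKernel hy).fderiv
  rw [laplacian_eq_sum_fderiv_fderiv, hev.fderiv_eq]
  set p : ℝ := -(n : ℝ) / 2 with hp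
  have hI : ∀ z : 𝔼 n, HasFDerivAt (fun y : 𝔼 n => innerSL ℝ (y - z))
      (innerSL ℝ : (𝔼 n) →L[ℝ] (𝔼 n) →L[ℝ] ℝ) x := fun z =>
    (innerSL ℝ : (𝔼 n) →L[ℝ] (𝔼 n) →L[ℝ] ℝ).hasFDerivAt.comp x ((hasFDerivAt_id x).sub_const z)
  have hI0 : HasFDerivAt (fun y : 𝔼 n => innerSL ℝ y)
      (innerSL ℝ : (𝔼 n) →L[ℝ] (𝔼 n) →L[ℝ] ℝ) x :=
    (innerSL ℝ : (𝔼 n) →L[ℝ] (𝔼 n) →L[ℝ] ℝ).hasFDerivAt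
  have hD := (((hasFDerivAt_norm_sub_sq_rpow h p).const_mul (-2)).smul hI0).sub
    ((((hasFDerivAt_one_sub_norm_sq x).const_mul (n : ℝ)).mul
      (hasFDerivAt_norm_sub_sq_rpow h (p - 1))).smul (hI η))
  have hD' : HasFDerivAt (fun y => ballPoissonKernelDeriv y η) _ x := hD
  rw [hD'.fderiv]
  set b := EuclideanSpace.basisFun (Fin n) ℝ
  set q : ℝ := ‖x - η‖ ^ 2 with hq
  have hb : ∀ i, (innerSL ℝ : (𝔼 n) →L[ℝ] (𝔼 n) →L[ℝ] ℝ) (b i) (b i) = 1 := fun i =>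
    (real_inner_self_eq_norm_sq (b i)).trans (by rw [b.norm_eq_one, one_pow])
  have hsum : ∀ u v : 𝔼 n, ∑ i, inner ℝ u (b i) * inner ℝ v (b i) = inner ℝ u v := fun u v => by
    rw [← b.sum_inner_mul_inner u v]
    exact Finset.sum_congr rfl fun i _ => by rw [real_inner_comm v]
  have hval : ∀ A B C D : ℝ, ∑ i : Fin n, (A + B * (inner ℝ (x - η) (b i) * inner ℝ x (b i)) +
      C * (inner ℝ (x - η) (b i) * inner ℝ (x - η) (b i)) + D) =
      n * A + B * inner ℝ (x - η) x + C * q + n * D := fun A B C D => by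
    rw [Finset.sum_add_distrib, Finset.sum_add_distrib, Finset.sum_add_distrib, ← Finset.mul_sum,
      ← Finset.mul_sum, hsum, hsum, real_inner_self_eq_norm_sq, ← hq]
    simp
  have hq0 : q ≠ 0 := by positivity
  have h1 : q ^ (p - 1) = q * q ^ (p - 1 - 1) := by
    rw [Real.rpow_sub_one hq0 (p - 1), mul_div_cancel₀ _ hq0]
  have h2 : q ^ p = q * (q * q ^ (p - 1 - 1)) := by
    rw [← h1, Real.rpow_sub_one hq0 p, mul_div_cancel₀ _ hq0]
  -- The second derivative in the direction `b i`, to be summed over `i`.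
  trans ∑ i : Fin n, (-2 * q ^ p +
      (-4 * p * q ^ (p - 1) + 2 * n * q ^ (p - 1)) * (inner ℝ (x - η) (b i) * inner ℝ x (b i)) +
      (-2 * n * (p - 1) * (1 - ‖x‖ ^ 2) * q ^ (p - 1 - 1)) *
        (inner ℝ (x - η) (b i) * inner ℝ (x - η) (b i)) + -n * (1 - ‖x‖ ^ 2) * q ^ (p - 1))
  · refine Finset.sum_congr rfl fun i _ => ?_
    simp only [add_apply, sub_apply, smul_apply, ContinuousLinearMap.smulRight_apply,
      innerSL_apply_apply, smul_eq_mul, Pi.mul_apply, hb]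
    ring
  · rw [hval, h1, h2]
    have h3 : q = ‖x‖ ^ 2 - 2 * inner ℝ x η + 1 := by
      rw [hq, norm_sub_sq_real, hη, one_pow]
    have h4 : inner ℝ (x - η) x = ‖x‖ ^ 2 - inner ℝ x η := by
      rw [inner_sub_left, real_inner_self_eq_norm_sq, real_inner_comm]
    have h5 : inner ℝ x η = (‖x‖ ^ 2 + 1 - q) / 2 := by linarith
    rw [h4, h5, hp]
    ring

end

/-! ### Integrals of smooth kernels over the sphere -/

section

variable {n : ℕ} {F : Type} [NormedAddCommGroup F] [NormedSpace ℝ F]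

/-- The kernel `K` is smooth at every point of ball × sphere. -/
def SmoothOnBallSphere (K : (𝔼 n) → (𝔼 n) → F) : Prop :=
  ∀ x η : 𝔼 n, ‖x‖ < 1 → ‖η‖ = 1 → ContDiffAt ℝ ∞ (Function.uncurry K) (x, η)

variable {K : (𝔼 n) → (𝔼 n) → F} {g : sphere (0 : 𝔼 n) 1 → ℝ} {M : ℝ} {x : 𝔼 n}

theorem SmoothOnBallSphere.fderiv_left (hK : SmoothOnBallSphere K) :
    SmoothOnBallSphere fun x η => fderiv ℝ (fun y => K y η) x := by
  intro x η hx hη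
  refine ContDiffAt.fderiv (f := fun (p : (𝔼 n) × (𝔼 n)) y => K y p.2) (g := Prod.fst) (n := ∞)
    ?_ contDiffAt_fst le_rfl
  have h : ContDiffAt ℝ ∞ (fun q : ((𝔼 n) × (𝔼 n)) × (𝔼 n) => (q.2, q.1.2)) ((x, η), x) := by
    fun_prop
  exact ContDiffAt.comp ((x, η), x) (hK x η hx hη) h

theorem SmoothOnBallSphere.continuous_right (hK : SmoothOnBallSphere K) (hx : ‖x‖ < 1) :
    Continuous fun η : sphere (0 : 𝔼 n) 1 => K x η := by
  rw [continuous_iff_continuousAt]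
  intro η
  have h : ContinuousAt (fun η : sphere (0 : 𝔼 n) 1 => (x, (η : 𝔼 n))) η := by fun_prop
  exact ContinuousAt.comp (g := Function.uncurry K)
    (f := fun η : sphere (0 : 𝔼 n) 1 => (x, (η : 𝔼 n))) (hK x η hx (by simp)).continuousAt h

theorem SmoothOnBallSphere.hasFDerivAt (hK : SmoothOnBallSphere K) (hx : ‖x‖ < 1) {η : 𝔼 n}
    (hη : ‖η‖ = 1) : HasFDerivAt (fun y => K y η) (fderiv ℝ (fun y => K y η) x) x := by
  have h : ContDiffAt ℝ ∞ (fun y : 𝔼 n => (y, η)) x := by fun_prop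
  have h2 : ContDiffAt ℝ ∞ (fun y => K y η) x :=
    ContDiffAt.comp (g := Function.uncurry K) x (hK x η hx hη) h
  exact (h2.differentiableAt (by simp)).hasFDerivAt

theorem SmoothOnBallSphere.aestronglyMeasurable_smul (hK : SmoothOnBallSphere K)
    (hg : Measurable g) (hx : ‖x‖ < 1) :
    AEStronglyMeasurable (fun η => g η • K x η) (sphereMeasure n) :=
  hg.aestronglyMeasurable.smul (hK.continuous_right hx).aestronglyMeasurable

theorem SmoothOnBallSphere.integrable_smul (hn : 0 < n) (hK : SmoothOnBallSphere K)
    (hg : Measurable g) (hM : ∀ η, |g η| ≤ M) (hx : ‖x‖ < 1) :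
    Integrable (fun η => g η • K x η) (sphereMeasure n) := by
  have := isProbabilityMeasure_sphereMeasure hn
  obtain ⟨C, hC⟩ := isCompact_univ.exists_bound_of_continuousOn
    (hK.continuous_right hx).continuousOn
  refine Integrable.of_bound (hK.aestronglyMeasurable_smul hg hx) (M * C)
    (Eventually.of_forall fun η => ?_)
  rw [norm_smul, Real.norm_eq_abs]
  exact mul_le_mul (hM η) (hC η (mem_univ _)) (norm_nonneg _) ((abs_nonneg _).trans (hM η))

/-- Differentiation under the integral over the sphere, for a smooth kernel and a bounded
measurable weight. -/
theorem SmoothOnBallSphere.hasFDerivAt_integral (hn : 0 < n) (hK : SmoothOnBallSphere K)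
    (hg : Measurable g) (hM : ∀ η, |g η| ≤ M) (hx : ‖x‖ < 1) :
    HasFDerivAt (fun y => ∫ η, g η • K y η ∂(sphereMeasure n))
      (∫ η, g η • fderiv ℝ (fun y => K y η) x ∂(sphereMeasure n)) x := by
  have := isProbabilityMeasure_sphereMeasure hn
  have hK1 := hK.fderiv_left
  set r := (1 - ‖x‖) / 2 with hr
  have hr0 : 0 < r := by rw [hr]; linarith
  have hball : ∀ y ∈ closedBall x r, ‖y‖ < 1 := fun y hy => by
    have h1 : ‖y - x‖ ≤ r := by simpa [dist_eq_norm] using hy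
    have h2 : ‖y‖ ≤ ‖y - x‖ + ‖x‖ := by simpa using norm_add_le (y - x) x
    linarith
  obtain ⟨C, hC⟩ := ((isCompact_closedBall x r).prod
    (isCompact_sphere (0 : 𝔼 n) 1)).exists_bound_of_continuousOn
    (f := Function.uncurry fun x η => fderiv ℝ (fun y => K y η) x)
    (fun p hp => (hK1 p.1 p.2 (hball _ hp.1) (by simpa using hp.2)).continuousAt.continuousWithinAt)
  refine hasFDerivAt_integral_of_dominated_of_fderiv_le (s := ball x r) (𝕜 := ℝ)
    (F := fun y η => g η • K y (η : 𝔼 n))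
    (F' := fun y η => g η • fderiv ℝ (fun y => K y (η : 𝔼 n)) y) (bound := fun _ => M * C)
    (ball_mem_nhds x hr0) ?_ (hK.integrable_smul hn hg hM hx)
    (hK1.aestronglyMeasurable_smul hg hx) ?_ (integrable_const _) ?_
  · filter_upwards [ball_mem_nhds x hr0] with y hy
    exact hK.aestronglyMeasurable_smul hg (hball y (ball_subset_closedBall hy))
  · refine Eventually.of_forall fun η y hy => ?_
    rw [norm_smul, Real.norm_eq_abs]
    exact mul_le_mul (hM η) (hC (y, η) ⟨ball_subset_closedBall hy, η.2⟩) (norm_nonneg _)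
      ((abs_nonneg _).trans (hM η))
  · refine Eventually.of_forall fun η y hy => ?_
    exact (hK.hasFDerivAt (hball y (ball_subset_closedBall hy)) (by simp)).const_smul (g η)

end

/-- Smoothness of the integral, by induction on the order: the derivative of the integral is the
integral of the differentiated kernel, which is again smooth. -/
theorem SmoothOnBallSphere.contDiffAt_integral {n : ℕ} (hn : 0 < n)
    {g : sphere (0 : 𝔼 n) 1 → ℝ} {M : ℝ} (hg : Measurable g) (hM : ∀ η, |g η| ≤ M) (m : ℕ) :
    ∀ {F : Type} [NormedAddCommGroup F] [NormedSpace ℝ F] {K : (𝔼 n) → (𝔼 n) → F}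
      (_ : SmoothOnBallSphere K) {x : 𝔼 n} (_ : ‖x‖ < 1),
      ContDiffAt ℝ m (fun y => ∫ η, g η • K y η ∂(sphereMeasure n)) x := by
  induction m with
  | zero =>
    intro F _ _ K hK x hx
    have hopen : {y : 𝔼 n | ‖y‖ < 1} ∈ 𝓝 x :=
      (isOpen_lt continuous_norm continuous_const).mem_nhds hx
    refine contDiffAt_zero.2 ⟨_, hopen, fun y hy => ?_⟩
    exact (hK.hasFDerivAt_integral hn hg hM hy).continuousAt.continuousWithinAt
  | succ m ih =>
    intro F _ _ K hK x hx
    have hopen : {y : 𝔼 n | ‖y‖ < 1} ∈ 𝓝 x :=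
      (isOpen_lt continuous_norm continuous_const).mem_nhds hx
    rw [Nat.cast_succ]
    exact contDiffAt_succ_iff_hasFDerivAt.2 ⟨_, ⟨_, hopen, fun y hy =>
      hK.hasFDerivAt_integral hn hg hM hy⟩, ih hK.fderiv_left hx⟩

set_option maxSynthPendingDepth 3 in
theorem integral_apply_apply {α : Type*} [MeasurableSpace α] {μ : Measure α} {E : Type*}
    [NormedAddCommGroup E] [NormedSpace ℝ E] {f : α → E →L[ℝ] E →L[ℝ] ℝ} (hf : Integrable f μ)
    (e e' : E) : (∫ a, f a ∂μ) e e' = ∫ a, f a e e' ∂μ := by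
  rw [ContinuousLinearMap.integral_apply hf, ContinuousLinearMap.integral_apply]
  exact hf.apply_continuousLinearMap e

set_option maxSynthPendingDepth 3 in
/-- The integral of a kernel which is harmonic in its first variable is harmonic. -/
theorem SmoothOnBallSphere.harmonicAt_integral {n : ℕ} (hn : 0 < n)
    {g : sphere (0 : 𝔼 n) 1 → ℝ} {M : ℝ} (hg : Measurable g) (hM : ∀ η, |g η| ≤ M)
    {K : (𝔼 n) → (𝔼 n) → ℝ} (hK : SmoothOnBallSphere K)
    (hΔ : ∀ x η : 𝔼 n, ‖x‖ < 1 → ‖η‖ = 1 → Δ (fun y => K y η) x = 0) {x : 𝔼 n} (hx : ‖x‖ < 1) :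
    HarmonicAt (fun y => ∫ η, g η • K y η ∂(sphereMeasure n)) x := by
  have hC := SmoothOnBallSphere.contDiffAt_integral hn hg hM 2 hK hx
  rw [Nat.cast_ofNat] at hC
  refine ⟨hC, ?_⟩
  have hopen : IsOpen {y : 𝔼 n | ‖y‖ < 1} := isOpen_lt continuous_norm continuous_const
  filter_upwards [hopen.mem_nhds hx] with y hy
  have h1 : fderiv ℝ (fun y => ∫ η, g η • K y η ∂(sphereMeasure n)) =ᶠ[𝓝 y]
      fun y => ∫ η, g η • fderiv ℝ (fun y => K y η) y ∂(sphereMeasure n) := by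
    filter_upwards [hopen.mem_nhds hy] with z hz
    exact (hK.hasFDerivAt_integral hn hg hM hz).fderiv
  have hK2 := hK.fderiv_left.fderiv_left
  have hint := hK2.integrable_smul hn hg hM hy
  rw [laplacian_eq_sum_fderiv_fderiv, h1.fderiv_eq,
    (hK.fderiv_left.hasFDerivAt_integral hn hg hM hy).fderiv]
  simp_rw [integral_apply_apply hint]
  rw [← integral_finsetSum _ fun i _ =>
    (hint.apply_continuousLinearMap _).apply_continuousLinearMap _]
  refine integral_eq_zero_of_ae (Eventually.of_forall fun η => ?_)
  have h2 := hΔ y η hy (by simp)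
  rw [laplacian_eq_sum_fderiv_fderiv] at h2
  simp only [smul_apply, ← Finset.smul_sum]
  rw [h2, smul_zero, Pi.zero_apply]

/-! ### The Poisson integral -/

section

variable {n : ℕ}

theorem ne_of_norm_lt_one_of_norm_eq_one {x η : 𝔼 n} (hx : ‖x‖ < 1) (hη : ‖η‖ = 1) : x ≠ η := by
  rintro rfl; linarith

theorem smoothOnBallSphere_ballPoissonKernel :
    SmoothOnBallSphere (ballPoissonKernel (n := n)) := fun _ _ hx hη =>
  contDiffAt_ballPoissonKernel (ne_of_norm_lt_one_of_norm_eq_one hx hη)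

theorem ballPoissonKernel_nonneg {x : 𝔼 n} (hx : ‖x‖ < 1) (η : 𝔼 n) :
    0 ≤ ballPoissonKernel x η :=
  mul_nonneg (one_sub_norm_sq_pos hx).le (by positivity)

theorem ballPoissonKernel_mul_pow {x η : 𝔼 n} (h : x ≠ η) :
    ballPoissonKernel x η * ‖x - η‖ ^ n = 1 - ‖x‖ ^ 2 := by
  have h0 : 0 < ‖x - η‖ := norm_pos_iff.2 (sub_ne_zero.2 h)
  rw [ballPoissonKernel, mul_assoc, ← Real.rpow_natCast_mul h0.le,
    ← Real.rpow_natCast ‖x - η‖ n,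
    ← Real.rpow_add h0]
  have : ((2 : ℕ) : ℝ) * (-(n : ℝ) / 2) + n = 0 := by push_cast; ring
  rw [this, Real.rpow_zero, mul_one]

theorem ballPoissonKernel_isometry (g : (𝔼 n) ≃ₗᵢ[ℝ] (𝔼 n)) (x η : 𝔼 n) :
    ballPoissonKernel (g x) (g η) = ballPoissonKernel x η := by
  rw [ballPoissonKernel, ballPoissonKernel, ← map_sub, g.norm_map, g.norm_map]

/-- The Poisson integral over the sphere of the boundary function `g`. -/
noncomputable def poissonIntegral (g : sphere (0 : 𝔼 n) 1 → ℝ) (y : 𝔼 n) : ℝ :=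
  ∫ η, g η • ballPoissonKernel y η ∂(sphereMeasure n)

variable {g : sphere (0 : 𝔼 n) 1 → ℝ} {M : ℝ} {x : 𝔼 n}

theorem harmonicAt_poissonIntegral (hn : 0 < n) (hg : Measurable g) (hM : ∀ η, |g η| ≤ M)
    (hx : ‖x‖ < 1) : HarmonicAt (poissonIntegral g) x :=
  smoothOnBallSphere_ballPoissonKernel.harmonicAt_integral hn hg hM
    (fun _ _ hx hη => laplacian_ballPoissonKernel (ne_of_norm_lt_one_of_norm_eq_one hx hη) hη) hx

theorem fderiv_poissonIntegral_apply (hn : 0 < n) (hg : Measurable g) (hM : ∀ η, |g η| ≤ M)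
    (hx : ‖x‖ < 1) (e : 𝔼 n) : fderiv ℝ (poissonIntegral g) x e =
      ∫ η, g η * ballPoissonKernelDeriv x (η : 𝔼 n) e ∂(sphereMeasure n) := by
  have h := smoothOnBallSphere_ballPoissonKernel.hasFDerivAt_integral hn hg hM hx
  have hint := smoothOnBallSphere_ballPoissonKernel.fderiv_left.integrable_smul hn hg hM hx
  rw [show fderiv ℝ (poissonIntegral g) x = _ from h.fderiv,
    ContinuousLinearMap.integral_apply hint]
  refine integral_congr_ae (Eventually.of_forall fun η => ?_)
  simp only [smul_apply, smul_eq_mul]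
  rw [(hasFDerivAt_ballPoissonKernel (ne_of_norm_lt_one_of_norm_eq_one hx (by simp))).fderiv]

/-- The Poisson kernel has total mass one: by rotation invariance its integral is constant on
spheres about the origin, hence constant by the maximum principle. -/
theorem integral_ballPoissonKernel (hn : 0 < n) (hx : ‖x‖ < 1) :
    ∫ η : sphere (0 : 𝔼 n) 1, ballPoissonKernel x η ∂(sphereMeasure n) = 1 := by
  have := isProbabilityMeasure_sphereMeasure hn
  set v : (𝔼 n) → ℝ := poissonIntegral fun _ => 1 with hv
  have hv' : ∀ y, v y = ∫ η : sphere (0 : 𝔼 n) 1, ballPoissonKernel y η ∂(sphereMeasure n) :=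
    fun y => by simp [hv, poissonIntegral]
  have hharm : HarmonicOnNhd v (closedBall 0 ‖x‖) := fun y hy =>
    harmonicAt_poissonIntegral hn measurable_const (M := 1) (by simp)
      ((mem_closedBall_zero_iff.1 hy).trans_lt hx)
  have hrad : ∀ z, ‖z‖ = ‖x‖ → v z = v x := by
    intro z hz
    set R := (ℝ ∙ (x - z))ᗮ.reflection
    have hR : R x = z := Submodule.reflection_sub hz.symm
    rw [hv', hv', ← hR, ← integral_sphereMeasure_comp_isometry hn R]
    simp_rw [ballPoissonKernel_isometry]
  have h0 : v 0 = 1 := by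
    rw [hv']
    simp [ballPoissonKernel]
  have h1 := le_of_harmonicOnNhd_of_le_on_sphere hn hharm (fun z hz => (hrad z hz).le)
    (y := 0) (by simp)
  have h2 := le_of_harmonicOnNhd_of_le_on_sphere hn hharm.neg (c := -v x)
    (fun z hz => by simp [hrad z hz]) (y := 0) (by simp)
  rw [← hv']
  simp only [Pi.neg_apply] at h2
  linarith

theorem integrable_mul_ballPoissonKernel (hn : 0 < n) (hg : Measurable g) (hM : ∀ η, |g η| ≤ M)
    (hx : ‖x‖ < 1) : Integrable (fun η => g η * ballPoissonKernel x η) (sphereMeasure n) :=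
  smoothOnBallSphere_ballPoissonKernel.integrable_smul hn hg hM hx

theorem integrable_ballPoissonKernel (hn : 0 < n) (hx : ‖x‖ < 1) :
    Integrable (fun η : sphere (0 : 𝔼 n) 1 => ballPoissonKernel x η) (sphereMeasure n) := by
  simpa using integrable_mul_ballPoissonKernel hn (g := fun _ => 1) measurable_const (M := 1)
    (by simp) hx

theorem abs_poissonIntegral_le (hn : 0 < n) (hM : ∀ η, |g η| ≤ M) (hx : ‖x‖ < 1) :
    |poissonIntegral g x| ≤ M := by
  have h := norm_integral_le_of_norm_le (f := fun η => g η • ballPoissonKernel x (η : 𝔼 n))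
    (g := fun η => M * ballPoissonKernel x (η : 𝔼 n))
    ((integrable_ballPoissonKernel hn hx).const_mul M) (Eventually.of_forall fun η => by
      rw [norm_smul, Real.norm_eq_abs, Real.norm_of_nonneg (ballPoissonKernel_nonneg hx _)]
      exact mul_le_mul_of_nonneg_right (hM η) (ballPoissonKernel_nonneg hx _))
  rwa [integral_const_mul, integral_ballPoissonKernel hn hx, mul_one] at h

theorem poissonIntegral_sub_const (hn : 0 < n) (hg : Measurable g) (hM : ∀ η, |g η| ≤ M)
    (hx : ‖x‖ < 1) (c : ℝ) : poissonIntegral g x - c =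
      ∫ η, (g η - c) * ballPoissonKernel x η ∂(sphereMeasure n) := by
  have h1 : ∫ η : sphere (0 : 𝔼 n) 1, c * ballPoissonKernel x η ∂(sphereMeasure n) = c := by
    rw [integral_const_mul, integral_ballPoissonKernel hn hx, mul_one]
  conv_lhs => rw [← h1]
  rw [poissonIntegral]
  simp_rw [smul_eq_mul, sub_mul]
  exact (integral_sub (integrable_mul_ballPoissonKernel hn hg hM hx)
    ((integrable_ballPoissonKernel hn hx).const_mul c)).symm

/-- Quantitative boundary behaviour of the Poisson integral of a continuous function. Uniform
continuity bounds `|h η - h z|` by `ε + C |z - η|ⁿ`, and the factor `|z - η|ⁿ` cancels the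
denominator of the kernel. -/
theorem exists_abs_poissonIntegral_sub_le (hn : 0 < n) {h : (𝔼 n) → ℝ}
    (hh : ContinuousOn h (closedBall 0 1)) {ε : ℝ} (hε : 0 < ε) :
    ∃ C : ℝ, ∀ z : 𝔼 n, ‖z‖ < 1 →
      |poissonIntegral (fun η => h η) z - h z| ≤ ε + C * (1 - ‖z‖ ^ 2) := by
  have hprob := isProbabilityMeasure_sphereMeasure hn
  have hcpt := isCompact_closedBall (0 : 𝔼 n) 1
  obtain ⟨B, hB⟩ := hcpt.exists_bound_of_continuousOn hh
  have hsph : ∀ η : sphere (0 : 𝔼 n) 1, (η : 𝔼 n) ∈ closedBall (0 : 𝔼 n) 1 := fun η => by simp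
  have hB0 : 0 ≤ B := (norm_nonneg _).trans (hB 0 (by simp))
  obtain ⟨δ, hδ, hδh⟩ := Metric.uniformContinuousOn_iff.1
    (hcpt.uniformContinuousOn_of_continuous hh) ε hε
  refine ⟨2 * B / δ ^ n, fun z hz => ?_⟩
  have hzc : z ∈ closedBall (0 : 𝔼 n) 1 := by simpa using hz.le
  have hosc : ∀ η : sphere (0 : 𝔼 n) 1, |h η - h z| ≤ ε + 2 * B / δ ^ n * ‖z - η‖ ^ n := by
    intro η
    by_cases hd : ‖z - η‖ < δ
    · have h1 := hδh _ (hsph η) _ hzc (by rwa [dist_comm, dist_eq_norm])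
      rw [Real.dist_eq] at h1
      have : 0 ≤ 2 * B / δ ^ n * ‖z - η‖ ^ n := by positivity
      linarith
    · have h1 : |h η - h z| ≤ 2 * B := by
        have e1 := hB _ (hsph η)
        have e2 := hB _ hzc
        have e3 := abs_sub (h η) (h z)
        rw [Real.norm_eq_abs] at e1 e2
        linarith
      have h2 : 2 * B ≤ 2 * B / δ ^ n * ‖z - η‖ ^ n := by
        rw [div_mul_eq_mul_div, le_div_iff₀ (by positivity)]
        exact mul_le_mul_of_nonneg_left (pow_le_pow_left₀ hδ.le (not_lt.1 hd) n) (by positivity)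
      linarith
  have hmeas : Measurable fun η : sphere (0 : 𝔼 n) 1 => h η :=
    (hh.comp_continuous continuous_subtype_val hsph).measurable
  have hK := integrable_ballPoissonKernel hn hz
  have heq : poissonIntegral (fun η => h η) z - h z =
      ∫ η : sphere (0 : 𝔼 n) 1, (h η - h z) * ballPoissonKernel z η ∂(sphereMeasure n) :=
    poissonIntegral_sub_const hn hmeas (fun η => hB _ (hsph η)) hz (h z)
  have hbound : ∀ η : sphere (0 : 𝔼 n) 1, ‖(h η - h z) * ballPoissonKernel z η‖ ≤
      ε * ballPoissonKernel z η + 2 * B / δ ^ n * (1 - ‖z‖ ^ 2) := by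
    intro η
    rw [← ballPoissonKernel_mul_pow (ne_of_norm_lt_one_of_norm_eq_one hz (η := η) (by simp)),
      norm_mul, Real.norm_of_nonneg (ballPoissonKernel_nonneg hz _), Real.norm_eq_abs]
    calc _ ≤ _ := mul_le_mul_of_nonneg_right (hosc η) (ballPoissonKernel_nonneg hz _)
      _ = _ := by ring
  rw [heq]
  refine (norm_integral_le_of_norm_le ((hK.const_mul ε).add (integrable_const _))
    (Eventually.of_forall hbound)).trans ?_
  rw [integral_add' (hK.const_mul ε) (integrable_const _), integral_const_mul,
    integral_ballPoissonKernel hn hz]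
  simp

/-- The Poisson formula for a function which is harmonic near the closed ball. -/
theorem poissonIntegral_eq_of_harmonicOnNhd (hn : 0 < n) {h : (𝔼 n) → ℝ}
    (hh : HarmonicOnNhd h (closedBall 0 1)) (hx : ‖x‖ < 1) :
    poissonIntegral (fun η => h η) x = h x := by
  have hcont := hh.continuousOn
  obtain ⟨B, hB⟩ := (isCompact_closedBall (0 : 𝔼 n) 1).exists_bound_of_continuousOn hcont
  have hsph : ∀ η : sphere (0 : 𝔼 n) 1, (η : 𝔼 n) ∈ closedBall (0 : 𝔼 n) 1 := fun η => by simp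
  have hmeas : Measurable fun η : sphere (0 : 𝔼 n) 1 => h η :=
    (hcont.comp_continuous continuous_subtype_val hsph).measurable
  set w : (𝔼 n) → ℝ := poissonIntegral (fun η => h η) - h with hw
  have hharm : ∀ ρ < 1, HarmonicOnNhd w (closedBall 0 ρ) := fun ρ hρ y hy => by
    have hy1 : ‖y‖ < 1 := (mem_closedBall_zero_iff.1 hy).trans_lt hρ
    exact (harmonicAt_poissonIntegral hn hmeas (fun η => hB _ (hsph η)) hy1).sub
      (hh y (by simpa using hy1.le))
  have key : ∀ ε > 0, |w x| ≤ ε := by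
    intro ε hε
    obtain ⟨C, hC⟩ := exists_abs_poissonIntegral_sub_le hn hcont hε
    have hρ : ∀ᶠ ρ in 𝓝[<] (1 : ℝ), |w x| ≤ ε + C * (1 - ρ ^ 2) := by
      filter_upwards [Ioo_mem_nhdsLT hx] with ρ hρ
      have hb : ∀ z : 𝔼 n, ‖z‖ = ρ → |w z| ≤ ε + C * (1 - ρ ^ 2) := fun z hz => by
        rw [← hz]; exact hC z (by rw [hz]; exact hρ.2)
      refine abs_le'.2 ⟨?_, ?_⟩
      · exact le_of_harmonicOnNhd_of_le_on_sphere hn (hharm ρ hρ.2)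
          (fun z hz => (abs_le'.1 (hb z hz)).1) hρ.1.le
      · exact le_of_harmonicOnNhd_of_le_on_sphere hn (hharm ρ hρ.2).neg
          (fun z hz => (abs_le'.1 (hb z hz)).2) hρ.1.le
    have hlim : Tendsto (fun ρ : ℝ => ε + C * (1 - ρ ^ 2)) (𝓝[<] 1) (𝓝 ε) := by
      have : Continuous fun ρ : ℝ => ε + C * (1 - ρ ^ 2) := by fun_prop
      have h2 := (this.tendsto 1).mono_left (nhdsWithin_le_nhds (s := Iio 1))
      simpa using h2
    exact ge_of_tendsto hlim hρ
  have h0 : |w x| ≤ 0 := le_of_forall_pos_le_add fun ε hε => by simpa using key ε hε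
  have := abs_nonpos_iff.1 h0
  exact sub_eq_zero.1 this

end

/-! ### The sharp gradient estimate -/

theorem laplacian_comp_smul {n : ℕ} (f : (𝔼 n) → ℝ) (c : ℝ) (x : 𝔼 n) :
    Δ (fun y => f (c • y)) x = c ^ 2 * Δ f (c • x) := by
  have h1 : fderiv ℝ (fun y => f (c • y)) = fun y => c • fderiv ℝ f (c • y) := by
    ext1 y
    exact fderiv_comp_smul c
  rw [laplacian_eq_sum_fderiv_fderiv, laplacian_eq_sum_fderiv_fderiv, h1, Finset.mul_sum]
  refine Finset.sum_congr rfl fun i _ => ?_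
  have h2 : fderiv ℝ (fun y => c • fderiv ℝ f (c • y)) x =
      c • c • fderiv ℝ (fderiv ℝ f) (c • x) := by
    rw [← fderiv_comp_smul (f := fderiv ℝ f) c]
    exact congrFun (fderiv_const_smul_field (𝕜 := ℝ) (f := fun y : 𝔼 n => fderiv ℝ f (c • y)) c) x
  rw [h2]
  simp only [smul_apply, smul_eq_mul]
  ring

theorem harmonicAt_comp_smul {n : ℕ} {f : (𝔼 n) → ℝ} {c : ℝ} {x : 𝔼 n}
    (hf : HarmonicAt f (c • x)) : HarmonicAt (fun y => f (c • y)) x := by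
  refine ⟨ContDiffAt.comp x hf.1 (by fun_prop), ?_⟩
  have ht : Tendsto (fun y : 𝔼 n => c • y) (𝓝 x) (𝓝 (c • x)) :=
    (continuous_const_smul c).tendsto x
  filter_upwards [ht.eventually hf.2] with y hy
  rw [laplacian_comp_smul, hy]
  simp

theorem inner_gradient_eq_fderiv {n : ℕ} (U : (𝔼 n) → ℝ) (x ℓ : 𝔼 n) :
    inner ℝ (gradient U x) ℓ = fderiv ℝ U x ℓ := by
  rw [gradient, toDual_symm_apply]

section

variable {n : ℕ} {x : 𝔼 n}

/-- The `L¹` norm over the sphere of the derivative of the Poisson kernel at `x` in the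
direction `ℓ`. -/
noncomputable def poissonDerivNorm (x ℓ : 𝔼 n) : ℝ :=
  ∫ η : sphere (0 : 𝔼 n) 1, |ballPoissonKernelDeriv x (η : 𝔼 n) ℓ| ∂(sphereMeasure n)

theorem continuous_ballPoissonKernelDeriv_apply (hx : ‖x‖ < 1) (ℓ : 𝔼 n) :
    Continuous fun η : sphere (0 : 𝔼 n) 1 => ballPoissonKernelDeriv x (η : 𝔼 n) ℓ := by
  have h := smoothOnBallSphere_ballPoissonKernel.fderiv_left.continuous_right hx
  have h2 := h.clm_apply (continuous_const (y := ℓ))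
  refine h2.congr fun η => ?_
  rw [(hasFDerivAt_ballPoissonKernel (ne_of_norm_lt_one_of_norm_eq_one hx (by simp))).fderiv]

theorem integrable_abs_ballPoissonKernelDeriv_apply (hn : 0 < n) (hx : ‖x‖ < 1) (ℓ : 𝔼 n) :
    Integrable (fun η : sphere (0 : 𝔼 n) 1 => |ballPoissonKernelDeriv x (η : 𝔼 n) ℓ|)
      (sphereMeasure n) := by
  have := isProbabilityMeasure_sphereMeasure hn
  exact (continuous_ballPoissonKernelDeriv_apply hx ℓ).abs.integrable_of_hasCompactSupport
    (HasCompactSupport.of_compactSpace _)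

theorem abs_fderiv_le_of_harmonicOnNhd_closedBall (hn : 0 < n) {h : (𝔼 n) → ℝ}
    (hh : HarmonicOnNhd h (closedBall 0 1)) {S : ℝ} (hS : ∀ y : 𝔼 n, ‖y‖ = 1 → |h y| ≤ S)
    (hx : ‖x‖ < 1) (ℓ : 𝔼 n) : |fderiv ℝ h x ℓ| ≤ S * poissonDerivNorm x ℓ := by
  have hsph : ∀ η : sphere (0 : 𝔼 n) 1, (η : 𝔼 n) ∈ closedBall (0 : 𝔼 n) 1 := fun η => by simp
  have hmeas : Measurable fun η : sphere (0 : 𝔼 n) 1 => h η :=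
    (hh.continuousOn.comp_continuous continuous_subtype_val hsph).measurable
  have hev : h =ᶠ[𝓝 x] poissonIntegral (fun η => h η) := by
    filter_upwards [(isOpen_lt continuous_norm continuous_const).mem_nhds hx] with y hy
    exact (poissonIntegral_eq_of_harmonicOnNhd hn hh hy).symm
  rw [hev.fderiv_eq, fderiv_poissonIntegral_apply hn hmeas (fun η => hS η (by simp)) hx,
    poissonDerivNorm, ← integral_const_mul]
  refine norm_integral_le_of_norm_le (f := fun η : sphere (0 : 𝔼 n) 1 =>
      h η * ballPoissonKernelDeriv x (η : 𝔼 n) ℓ)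
    ((integrable_abs_ballPoissonKernelDeriv_apply hn hx ℓ).const_mul S)
    (Eventually.of_forall fun η => ?_)
  rw [norm_mul, Real.norm_eq_abs, Real.norm_eq_abs]
  exact mul_le_mul_of_nonneg_right (hS η (by simp)) (abs_nonneg _)

/-- The gradient estimate, obtained from the dilates `U (r ·)` with `r < 1`, which are harmonic near
the closed ball, by letting `r` tend to one. -/
theorem abs_fderiv_le_of_harmonicOnNhd_ball (hn : 0 < n) {U : (𝔼 n) → ℝ}
    (hU : HarmonicOnNhd U (ball 0 1)) {S : ℝ} (hS : ∀ y : 𝔼 n, ‖y‖ < 1 → |U y| ≤ S)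
    (hx : ‖x‖ < 1) (ℓ : 𝔼 n) : |fderiv ℝ U x ℓ| ≤ S * poissonDerivNorm x ℓ := by
  have hr : ∀ᶠ r in 𝓝[<] (1 : ℝ), |r * fderiv ℝ U (r • x) ℓ| ≤ S * poissonDerivNorm x ℓ := by
    filter_upwards [Ioo_mem_nhdsLT zero_lt_one] with r hr
    have hsmul : ∀ y : 𝔼 n, ‖y‖ ≤ 1 → ‖r • y‖ < 1 := fun y hy => by
      rw [norm_smul, Real.norm_of_nonneg hr.1.le]
      nlinarith [hr.1, hr.2, norm_nonneg y]
    have h := abs_fderiv_le_of_harmonicOnNhd_closedBall hn (h := fun y => U (r • y)) (S := S)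
      (fun y hy => harmonicAt_comp_smul (hU _ (by simpa using hsmul y (by simpa using hy))))
      (fun y hy => hS _ (hsmul y hy.le)) hx ℓ
    rwa [fderiv_comp_smul r, smul_apply, smul_eq_mul] at h
  have hcont : ContinuousAt (fun r : ℝ => |r * fderiv ℝ U (r • x) ℓ|) 1 := by
    have h1 : ContinuousAt (fderiv ℝ U) ((1 : ℝ) • x) := by
      rw [one_smul]
      exact ((hU x (by simpa using hx)).1.fderiv_right (m := 1) (by norm_num)).continuousAt
    have h2 : ContinuousAt (fun r : ℝ => fderiv ℝ U (r • x)) 1 :=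
      ContinuousAt.comp (f := fun r : ℝ => r • x) h1 (by fun_prop)
    exact (continuousAt_id.mul (h2.clm_apply continuousAt_const)).abs
  have h := le_of_tendsto (hcont.tendsto.mono_left nhdsWithin_le_nhds) hr
  simpa using h

/-- The differential of the Poisson kernel at the second endpoint of a chord. -/
theorem ballPoissonKernelDeriv_chordMap (hn : 0 < n) {η : 𝔼 n} (hx : ‖x‖ < 1) (hη : ‖η‖ = 1)
    (ℓ : 𝔼 n) :
    ballPoissonKernelDeriv x (chordMap x η) ℓ =
      -(n : ℝ) * inner ℝ (η - (((n : ℝ) - 2) / n) • x) ℓ * (‖η - x‖ / (1 - ‖x‖ ^ 2)) ^ n := by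
  have h1 := norm_pos_iff.2 (sub_ne_zero_of_norm_lt hx hη)
  have h2 := one_sub_norm_sq_pos hx
  have hn' : (n : ℝ) ≠ 0 := by positivity
  have e1 : x - chordMap x η = ((1 - ‖x‖ ^ 2) / ‖η - x‖ ^ 2) • (η - x) := by
    rw [chordMap]; module
  have e2 : ‖x - chordMap x η‖ = (1 - ‖x‖ ^ 2) / ‖η - x‖ := by
    rw [norm_sub_rev, norm_chordMap_sub hx hη]
  have e3 : (((1 - ‖x‖ ^ 2) / ‖η - x‖) ^ 2) ^ (-(n : ℝ) / 2) =
      (‖η - x‖ / (1 - ‖x‖ ^ 2)) ^ n := by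
    rw [← Real.rpow_natCast_mul (by positivity)]
    have : ((2 : ℕ) : ℝ) * (-(n : ℝ) / 2) = -n := by push_cast; ring
    rw [this, Real.rpow_neg (by positivity), Real.rpow_natCast, ← inv_pow, inv_div]
  have e4 : (((1 - ‖x‖ ^ 2) / ‖η - x‖) ^ 2) ^ (-(n : ℝ) / 2 - 1) =
      (‖η - x‖ / (1 - ‖x‖ ^ 2)) ^ n * (‖η - x‖ / (1 - ‖x‖ ^ 2)) ^ 2 := by
    rw [Real.rpow_sub_one (by positivity), e3]
    field_simp
  rw [ballPoissonKernelDeriv, e2, e3, e4, e1]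
  generalize (‖η - x‖ / (1 - ‖x‖ ^ 2)) ^ n = t
  simp only [sub_apply, smul_apply, innerSL_apply_apply, real_inner_smul_left, inner_sub_left,
    smul_eq_mul]
  field_simp
  ring

theorem poissonDerivNorm_eq_sphereFactor (hn : 2 ≤ n) (hx : ‖x‖ < 1) (ℓ : 𝔼 n) :
    poissonDerivNorm x ℓ = (1 - ‖x‖)⁻¹ * sphereFactor x ℓ := by
  have h2 := one_sub_norm_sq_pos hx
  have h3 : 0 < 1 - ‖x‖ := by linarith
  have h4 : 0 < 1 + ‖x‖ := by linarith [norm_nonneg x]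
  rw [poissonDerivNorm, integral_sphereMeasure_chordMap (by omega) hx
    (fun η => |ballPoissonKernelDeriv x η ℓ|), sphereFactor, ← mul_assoc, ← integral_const_mul]
  refine integral_congr_ae (Eventually.of_forall fun η => ?_)
  have hη : ‖(η : 𝔼 n)‖ = 1 := by simp
  have h1 := norm_pos_iff.2 (sub_ne_zero_of_norm_lt hx hη)
  simp only
  rw [ballPoissonKernelDeriv_chordMap (by omega) hx hη, abs_mul, abs_mul, abs_neg, Nat.abs_cast,
    abs_of_pos (a := _ ^ n) (by positivity), zpow_sub₀ h1.ne', zpow_natCast]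
  obtain ⟨m, rfl⟩ : ∃ m, n = m + 1 := ⟨n - 1, by omega⟩
  have h5 : 1 - ‖x‖ ^ 2 = (1 - ‖x‖) * (1 + ‖x‖) := by ring
  rw [h5, Nat.add_sub_cancel]
  generalize |inner ℝ ((η : 𝔼 (m + 1)) - _) ℓ| = a
  norm_cast
  simp only [div_pow, mul_pow]
  field_simp
  ring

/-- The sharp constant is attained by the Poisson integral of the sign of the directional derivative
of the kernel. -/
theorem isLeast_admissibleConstants (hn : 0 < n) (hx : ‖x‖ < 1) (ℓ : 𝔼 n) :
    IsLeast (admissibleConstants x ℓ) (poissonDerivNorm x ℓ) := by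
  have hne : Nonempty (ball (0 : 𝔼 n) 1) := ⟨⟨0, by simp⟩⟩
  constructor
  · intro U hU
    have hbdd : BddAbove (range fun y : ball (0 : 𝔼 n) 1 => |U y|) := by
      refine hU.2.mono ?_
      rintro _ ⟨y, rfl⟩
      exact ⟨y, y.2, rfl⟩
    rw [inner_gradient_eq_fderiv, mul_comm]
    exact abs_fderiv_le_of_harmonicOnNhd_ball hn hU.1
      (fun y hy => le_ciSup hbdd ⟨y, by simpa using hy⟩) hx ℓ
  · intro c hc
    -- Nonnegativity, from `U = 1`, lets the supremum below be replaced by its upper bound one.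
    have hc0 : 0 ≤ c := by
      have h := hc (fun _ => 1) ⟨harmonicOnNhd_const 1, ⟨1, by rintro _ ⟨y, -, rfl⟩; simp⟩⟩
      have h' := (abs_nonneg _).trans h
      simpa using h'
    set g : sphere (0 : 𝔼 n) 1 → ℝ := fun η =>
      if 0 ≤ ballPoissonKernelDeriv x (η : 𝔼 n) ℓ then 1 else -1 with hg
    have hgm : Measurable g := by
      refine Measurable.ite ?_ measurable_const measurable_const
      exact measurableSet_le measurable_const
        (continuous_ballPoissonKernelDeriv_apply hx ℓ).measurable
    have hg1 : ∀ η, |g η| ≤ 1 := fun η => by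
      simp only [hg]; split_ifs <;> simp
    have hle : ∀ y : 𝔼 n, ‖y‖ < 1 → |poissonIntegral g y| ≤ 1 := fun y hy =>
      abs_poissonIntegral_le hn hg1 hy
    have h := hc (poissonIntegral g) ⟨fun y hy => harmonicAt_poissonIntegral hn hgm hg1
      (by simpa using hy), ⟨1, by rintro _ ⟨y, hy, rfl⟩; exact hle y (by simpa using hy)⟩⟩
    have hval : fderiv ℝ (poissonIntegral g) x ℓ = poissonDerivNorm x ℓ := by
      rw [fderiv_poissonIntegral_apply hn hgm hg1 hx, poissonDerivNorm]
      refine integral_congr_ae (Eventually.of_forall fun η => ?_)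
      simp only [hg]
      split_ifs with h0
      · rw [one_mul, abs_of_nonneg h0]
      · rw [neg_one_mul, abs_of_neg (not_le.1 h0)]
    rw [inner_gradient_eq_fderiv, hval] at h
    have hsup : ⨆ y : ball (0 : 𝔼 n) 1, |poissonIntegral g y| ≤ 1 :=
      ciSup_le fun y => hle y (mem_ball_zero_iff.1 y.2)
    calc poissonDerivNorm x ℓ ≤ _ := (le_abs_self _).trans h
      _ ≤ c * 1 := mul_le_mul_of_nonneg_left hsup hc0
      _ = c := mul_one c

end

end

theorem lemma2p2 (n : ℕ) (hn : 2 ≤ n) (x ℓ : EuclideanSpace ℝ (Fin n))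
    (hx : ‖x‖ < 1) (hℓ : ‖ℓ‖ = 1) :
    IsLeast (admissibleConstants x ℓ) (optimalConstant x ℓ) ∧
      optimalConstant x ℓ = (1 - ‖x‖)⁻¹ * sphereFactor x ℓ := by
  have h := isLeast_admissibleConstants (by omega) hx ℓ
  have heq : optimalConstant x ℓ = poissonDerivNorm x ℓ := h.csInf_eq
  rw [heq]
  exact ⟨h, poissonDerivNorm_eq_sphereFactor hn hx ℓ⟩
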